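/- Let $\mathbb D$ be the open unit disc, $H^\infty$ the algebra of bounded analytic functions in $\mathbb D$, $H^2$ the Hardy space on $\mathbb D$, and $S$ the unilateral shift, i.e. multiplication by the independent variable on $H^2$; for $g\in H^\infty$, $g(S)$ is multiplication by $g$ on $H^2$. Let $g,\eta,h,\omega\in H^\infty$, where $\omega$ is inner (its radial limits exist and have modulus $1$ almost everywhere on the unit circle), and suppose that $$1=g\eta+\omega h .$$ Let $T\colon\mathcal H\to\mathcal H$ be a polynomially bounded operator on a complex Hilbert space, i.e. there is a constant $C$ with $\|p(T)\|\le C\sup_{z\in\mathbb D}|p(z)|$ for every polynomial $p$. Let $Y\colon\mathcal H\to H^2$ be a quasiaffinity (a bounded operator with $\ker Y=\{0\}$ and dense range) such that $(Y,S)$ is an isometric asymptote of $T$, and let $X\colon H^2\to\mathcal H$ be a bounded operator such that $YX=g(S)$. Here $(Y,V)$, with $V$ an isometry on a Hilbert space $\mathcal K$ and $Y\colon\mathcal H\to\mathcal K$, is called an isometric asymptote of $T$ if $Y=ZY_0$ and $ZV_0=VZ$ for some invertible operator $Z$ on $\mathcal K$ and some canonical pair $(Y_0,V_0)$: $V_0$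 is an isometry on $\mathcal K$, $Y_0T=V_0Y_0$, $Y_0$ has dense range, and there is a Banach limit $L$ with $\|Y_0x\|^2=L\big((\|T^nx\|^2)_{n\ge0}\big)$ for all $x\in\mathcal H$. (With $Z=I$ this is the canonical pair itself.) Then $T$ is absolutely continuous, i.e. there is a unique $H^\infty$-functional calculus $f\mapsto f(T)$: a unital algebra homomorphism from $H^\infty$ to the bounded operators on $\mathcal H$ which sends the function $z$ to $T$ and sends boundedly pointwise convergent sequences in $H^\infty$ to sequences convergent in the weak operator topology. Moreover, put $\mathcal M=\operatorname{clos}\omega(T)\mathcal H$, which is an invariant subspace of $T$. If $T|_{\mathcal M}$ is similar to $S$, then $T$ is similar to $S$. (Operators $A$ and $B$ are similar if $ZA=BZ$ for some bounded operator $Z$ with bounded inverse.) -/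

import Mathlib

open Filter Topology Polynomial MeasureTheory
open scoped BoundedContinuousFunction

noncomputable section

namespace HardyOp

/-! ### The algebra `H^∞` and inner functions -/

/-- The open unit disc. -/
abbrev Disc : Set ℂ := Metric.ball (0 : ℂ) 1

/-- A function on the disc, extended by zero to the plane. -/
def extendZero (f : Disc → ℂ) : ℂ → ℂ := Function.extend (Subtype.val : Disc → ℂ) f 0

theorem extendZero_apply (f : Disc → ℂ) (z : Disc) : extendZero f z = f z :=
  Subtype.val_injective.extend_apply f 0 z

theorem extendZero_of_mem (f : Disc → ℂ) {z : ℂ} (hz : z ∈ Disc) :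
    extendZero f z = f ⟨z, hz⟩ :=
  extendZero_apply f ⟨z, hz⟩

/-- `f : 𝔻 → ℂ` is analytic in the open unit disc. -/
def AnalyticOnDisc (f : Disc → ℂ) : Prop := DifferentiableOn ℂ (extendZero f) Disc

theorem analyticOnDisc_of_restrict {F : ℂ → ℂ} (hF : DifferentiableOn ℂ F Disc) :
    AnalyticOnDisc (fun z : Disc => F z) :=
  hF.congr fun _ hz => extendZero_of_mem _ hz

/-- The algebra `H^∞` of bounded analytic functions in the open unit disc, with pointwise
operations. -/
def HInfty : Subalgebra ℂ (Disc → ℂ) where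
  carrier := {f | AnalyticOnDisc f ∧ ∃ C : ℝ, ∀ z, ‖f z‖ ≤ C}
  mul_mem' := by
    rintro f g ⟨hf, C, hC⟩ ⟨hg, D, hD⟩
    refine ⟨(DifferentiableOn.mul hf hg).congr fun z hz => ?_, C * D, fun z => ?_⟩
    · simp [extendZero_of_mem _ hz]
    · rw [Pi.mul_apply, norm_mul]
      exact mul_le_mul (hC z) (hD z) (norm_nonneg _) ((norm_nonneg _).trans (hC z))
  add_mem' := by
    rintro f g ⟨hf, C, hC⟩ ⟨hg, D, hD⟩
    refine ⟨(DifferentiableOn.add hf hg).congr fun z hz => ?_, C + D, fun z => ?_⟩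
    · simp [extendZero_of_mem _ hz]
    · exact (norm_add_le _ _).trans (add_le_add (hC z) (hD z))
  algebraMap_mem' := by
    intro c
    refine ⟨(differentiableOn_const c).congr fun z hz => ?_, ‖c‖, fun z => ?_⟩
    · simp [extendZero_of_mem _ hz]
    · simp

/-- The independent variable `z`, as an element of `H^∞`. -/
def coordFun : HInfty :=
  ⟨fun z => (z : ℂ), analyticOnDisc_of_restrict differentiableOn_id, 1,
    fun z => (mem_ball_zero_iff.mp z.2).le⟩

/-- `f ∈ H^∞` is inner: for almost every point `ζ = exp(it)` of the unit circle the radial limit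
of `f` at `ζ` exists and has modulus one. -/
def IsInnerFun (f : HInfty) : Prop :=
  ∀ᵐ t : ℝ, ∃ w : ℂ, ‖w‖ = 1 ∧
    Tendsto (fun r : ℝ => extendZero f.1 (r * Complex.exp (t * Complex.I))) (𝓝[<] 1) (𝓝 w)

/-! ### The Hardy space `H^2` and the unilateral shift -/

/-- The Hardy space `H^2`: an analytic function `∑ aₙ zⁿ` in the disc with `∑ |aₙ|² < ∞` is
represented by its sequence of Taylor coefficients, and the norm is `(∑ |aₙ|²)^(1/2)`. -/
abbrev H2 : Type := lp (fun _ : ℕ => ℂ) 2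

/-- The value at `z ∈ 𝔻` of an element of `H^2`. -/
def H2.eval (u : H2) (z : Disc) : ℂ := ∑' n : ℕ, u n * (z : ℂ) ^ n

theorem H2.summable_sq (u : H2) : Summable fun n => ‖u n‖ ^ (2 : ℝ) := by
  simpa using (lp.memℓp u).summable (by simp)

theorem H2.summable_eval (u : H2) (z : Disc) : Summable fun n : ℕ => u n * (z : ℂ) ^ n := by
  have hz : ‖(z : ℂ)‖ < 1 := mem_ball_zero_iff.mp z.2
  refine Summable.of_norm_bounded (g := fun n : ℕ => ‖u‖ * ‖(z : ℂ)‖ ^ n)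
    ((summable_geometric_of_lt_one (norm_nonneg _) hz).mul_left _) fun n => ?_
  rw [norm_mul, norm_pow]
  exact mul_le_mul_of_nonneg_right (lp.norm_apply_le_norm (by simp) u n) (by positivity)

/-- The coefficients of `z ↦ z u(z)`. -/
def shiftSeq (a : ℕ → ℂ) : ℕ → ℂ
  | 0 => 0
  | n + 1 => a n

/-- The unilateral shift `S` on `H^2`, multiplication by the independent variable
(see `H2.eval_shift`). -/
def shift : H2 →L[ℂ] H2 :=
  LinearMap.mkContinuous
    { toFun := fun u => ⟨shiftSeq u, by
        refine memℓp_gen ?_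
        rw [← summable_nat_add_iff 1]
        simpa [shiftSeq] using u.summable_sq⟩
      map_add' := fun u v => by
        ext n
        cases n
        · exact (add_zero (0 : ℂ)).symm
        · rfl
      map_smul' := fun c u => by
        ext n
        cases n <;> simp [shiftSeq] } 1 (fun u => by
    rw [one_mul]
    refine le_of_eq ?_
    have h2 : 0 < (2 : ENNReal).toReal := by simp
    rw [lp.norm_eq_tsum_rpow h2, lp.norm_eq_tsum_rpow h2]
    congr 1
    rw [Summable.tsum_eq_zero_add]
    · simp [shiftSeq]
    · rw [← summable_nat_add_iff 1]
      simpa [shiftSeq] using u.summable_sq)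

theorem H2.eval_shift (u : H2) (z : Disc) : H2.eval (shift u) z = (z : ℂ) * H2.eval u z := by
  have h0 : shift u 0 = 0 := rfl
  have h1 : ∀ n : ℕ, shift u (n + 1) = u n := fun _ => rfl
  unfold H2.eval
  rw [(H2.summable_eval (shift u) z).tsum_eq_zero_add, ← tsum_mul_left]
  simp only [h0, h1, zero_mul, zero_add]
  exact tsum_congr fun n => by ring

/-- `A = g(S)`: the operator `A` on `H^2` is multiplication by `g ∈ H^∞`, that is
`(A u)(z) = g(z) u(z)` for all `u ∈ H^2` and `z ∈ 𝔻`. -/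
def IsMulBy (g : HInfty) (A : H2 →L[ℂ] H2) : Prop :=
  ∀ (u : H2) (z : Disc), H2.eval (A u) z = g.1 z * H2.eval u z

/-! ### Operators on Hilbert spaces -/

section Operators

variable {H : Type*} [NormedAddCommGroup H] [InnerProductSpace ℂ H]
variable {K : Type*} [NormedAddCommGroup K] [InnerProductSpace ℂ K]

/-- `T` is polynomially bounded: `‖p(T)‖ ≤ C sup_{|z| < 1} |p(z)|` for every polynomial `p`.
(The supremum is over a bounded non-empty set.) -/
def PolynomiallyBounded (T : H →L[ℂ] H) : Prop :=
  ∃ C : ℝ, ∀ p : ℂ[X], ‖aeval T p‖ ≤ C * ⨆ z : Disc, ‖p.eval (z : ℂ)‖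

/-- A quasiaffinity: an operator with zero kernel and dense range. -/
def Quasiaffinity (Y : H →L[ℂ] K) : Prop := Function.Injective Y ∧ DenseRange Y

/-- `T ≈ R`: there is a bounded invertible `Z` with bounded inverse such that `Z T = R Z`. -/
def AreSimilar (T : H →L[ℂ] H) (R : K →L[ℂ] K) : Prop :=
  ∃ Z : H ≃L[ℂ] K, ∀ x, Z (T x) = R (Z x)

/-- A Banach limit: a positive, normalized, shift-invariant linear functional on the space of
bounded real sequences. -/
structure IsBanachLimit (L : (ℕ →ᵇ ℝ) →ₗ[ℝ] ℝ) : Prop where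
  nonneg : ∀ s : ℕ →ᵇ ℝ, (∀ n, 0 ≤ s n) → 0 ≤ L s
  one : L 1 = 1
  shift : ∀ s t : ℕ →ᵇ ℝ, (∀ n, t n = s (n + 1)) → L t = L s

/-- `(Y, V)` is (up to unitary equivalence) the pair constructed from `T` and some Banach limit
`L`: the space `K` is the completion of `H / ker` for the semi-norm `x ↦ (L (‖Tⁿ x‖²)ₙ)^(1/2)`,
`Y` is the natural map, and `V` is the isometry induced by `T`. The existence of the bounded
sequence `s` says that the orbits of `T` are bounded. -/
structure IsCanonicalAsymptote (T : H →L[ℂ] H) (Y : H →L[ℂ] K) (V : K →L[ℂ] K) : Prop where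
  isometry : Isometry V
  intertwine : ∀ x, Y (T x) = V (Y x)
  dense : DenseRange Y
  norm_eq : ∃ L : (ℕ →ᵇ ℝ) →ₗ[ℝ] ℝ, IsBanachLimit L ∧
    ∀ x, ∃ s : ℕ →ᵇ ℝ, (∀ n, s n = ‖(T ^ n) x‖ ^ 2) ∧ ‖Y x‖ ^ 2 = L s

/-- `(Y, V)` is an isometric asymptote of `T`: `V` is an isometry, and the pair `(Y, V)` is the
image of a canonical one under an invertible operator `Z` (different Banach limits give pairs
which differ by such a `Z`). The case `Z = 1` is the canonical pair itself. -/
def IsIsometricAsymptote (T : H →L[ℂ] H) (Y : H →L[ℂ] K) (V : K →L[ℂ] K) : Prop :=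
  Isometry V ∧ ∃ (Y₀ : H →L[ℂ] K) (V₀ : K →L[ℂ] K) (Z : K ≃L[ℂ] K),
    IsCanonicalAsymptote T Y₀ V₀ ∧ (∀ x, Y x = Z (Y₀ x)) ∧ ∀ y, Z (V₀ y) = V (Z y)

/-- `Φ` is the `H^∞`-functional calculus `f ↦ f(T)`: a unital algebra homomorphism with
`Φ(z) = T` which is weak-* continuous, i.e. maps boundedly pointwise convergent sequences in
`H^∞` to sequences convergent in the weak operator topology. -/
structure IsHInftyCalculus (T : H →L[ℂ] H) (Φ : HInfty →ₐ[ℂ] (H →L[ℂ] H)) : Prop where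
  map_coord : Φ coordFun = T
  weakStar : ∀ (f : ℕ → HInfty) (f₀ : HInfty),
    (∃ C : ℝ, ∀ n z, ‖(f n).1 z‖ ≤ C) →
    (∀ z, Tendsto (fun n => (f n).1 z) atTop (𝓝 (f₀.1 z))) →
    ∀ x y : H, Tendsto (fun n => inner ℂ y (Φ (f n) x)) atTop (𝓝 (inner ℂ y (Φ f₀ x)))

/-- The subspace `clos A H`. -/
abbrev closRange (A : H →L[ℂ] H) : Submodule ℂ H := A.range.topologicalClosure

/-- `clos f(T)H` is invariant for `T`. -/
theorem IsHInftyCalculus.invariant {T : H →L[ℂ] H} {Φ : HInfty →ₐ[ℂ] (H →L[ℂ] H)}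
    (hΦ : IsHInftyCalculus T Φ) (f : HInfty) :
    ∀ x ∈ closRange (Φ f), T x ∈ closRange (Φ f) := by
  have hcomm : T * Φ f = Φ f * T := by
    rw [← hΦ.map_coord, ← map_mul, ← map_mul, mul_comm]
  intro x hx
  refine map_mem_closure T.continuous hx ?_
  rintro _ ⟨y, rfl⟩
  exact ⟨T y, (DFunLike.congr_fun hcomm y).symm⟩

end Operators

end HardyOp

end

open HardyOp

namespace HardyOp

/-! ### Polynomial approximation in `H^∞` -/

/-! Since `Y` is injective and intertwines `T` with the shift, the functionals `E z` (apply `Y`,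
evaluate at `z`) separate points and are eigenfunctionals of `T`. So `f(T)x` can only be the vector
on which `E z` takes the value `f(z) E z x`; it is obtained as a weak limit of `p n (T) x` for
polynomials `p n → f` (`exists_calculus`). Injectivity of `Y` also turns `YX = g(S)` into `XY =
g(T)`, whence `x = X Y η(T)x + (ωh)(T)x`. The first summand is controlled by the asymptotic norm of
`x` because `η(T)` commutes with `T`. The second lies in `clos ω(T)H`, where the powers of `T` are
uniformly bounded below, so its norm is controlled by its asymptotic norm, hence by that of `x`.
Thus `Y` is bounded below; having dense range, it is the required similarity
(`IsIsometricAsymptote.areSimilar_of_decomposition`). -/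

theorem exists_polynomial_approx {F : ℂ → ℂ} (hF : DifferentiableOn ℂ F Disc) {r ε : ℝ}
    (hr0 : 0 < r) (hr1 : r < 1) (hε : 0 < ε) :
    ∃ p : ℂ[X], ∀ z ∈ Disc, ‖p.eval z - F (r * z)‖ < ε := by
  -- The Taylor series of `F` on the ball of radius `R` converges uniformly on the smaller ball of
  -- radius `r`.
  obtain ⟨R, hrR, hR1⟩ := exists_between hr1
  lift R to NNReal using (hr0.trans hrR).le
  lift r to NNReal using hr0.le
  have hps := (hF.mono (Metric.closedBall_subset_ball hR1)).hasFPowerSeriesOnBall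
    (by exact_mod_cast hr0.trans hrR)
  have hrR' : (r : ENNReal) < R := by exact_mod_cast hrR
  obtain ⟨N, hN⟩ := ((Metric.tendstoUniformlyOn_iff.mp (hps.tendstoUniformlyOn hrR')) ε hε).exists
  refine ⟨∑ k ∈ Finset.range N, C ((cauchyPowerSeries F 0 R).coeff k) * (C ((r : ℝ) : ℂ) * X) ^ k,
    fun z hz => ?_⟩
  have hz1 : ‖z‖ < 1 := mem_ball_zero_iff.mp hz
  have hmem : ((r : ℝ) : ℂ) * z ∈ Metric.ball (0 : ℂ) r := by
    rw [mem_ball_zero_iff, norm_mul]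
    simpa using mul_lt_mul_of_pos_left hz1 hr0
  have := hN _ hmem
  rw [dist_comm, dist_eq_norm, zero_add] at this
  refine lt_of_eq_of_lt (congrArg (fun w => ‖w - F (r * z)‖) ?_) this
  rw [eval_finsetSum]
  refine Finset.sum_congr rfl fun k _ => ?_
  rw [FormalMultilinearSeries.apply_eq_pow_smul_coeff, eval_mul, eval_C, eval_pow, eval_mul,
    eval_C, eval_X, smul_eq_mul, mul_comm]

theorem exists_polynomial_tendsto (f : HInfty) {B : ℝ} (hB : ∀ z, ‖f.1 z‖ ≤ B) :
    ∃ p : ℕ → ℂ[X], (∀ n, ∀ z : Disc, ‖(p n).eval (z : ℂ)‖ ≤ B + 1) ∧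
      ∀ z : Disc, Tendsto (fun n => (p n).eval (z : ℂ)) atTop (𝓝 (f.1 z)) := by
  have hF : DifferentiableOn ℂ (extendZero f.1) Disc := f.2.1
  -- The shift by 2 keeps `r 0` positive. The approximation error below is `1 / (n + 1) ≤ 1`, hence
  -- the bound `B + 1`.
  set r : ℕ → ℝ := fun n => 1 - 1 / ((n : ℝ) + 2) with hr
  have hr0 : ∀ n, 0 < r n := fun n => by
    have : 1 / ((n : ℝ) + 2) < 1 := by
      rw [div_lt_one (by positivity)]; linarith [n.cast_nonneg (α := ℝ)]
    simp only [hr]; linarith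
  have hr1 : ∀ n, r n < 1 := fun n => by
    have : 0 < 1 / ((n : ℝ) + 2) := by positivity
    simp only [hr]; linarith
  have hrlim : Tendsto r atTop (𝓝 1) := by
    have h1 : Tendsto (fun n : ℕ => 1 / ((n : ℝ) + 2)) atTop (𝓝 0) := by
      have h2 := (tendsto_add_atTop_iff_nat 1).mpr (tendsto_one_div_add_atTop_nhds_zero_nat (𝕜 := ℝ))
      refine h2.congr fun n => ?_
      push_cast
      ring
    simpa only [sub_zero] using h1.const_sub 1
  have hscale : ∀ n, ∀ z : Disc, ((r n : ℝ) : ℂ) * (z : ℂ) ∈ Disc := fun n z => by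
    rw [mem_ball_zero_iff, norm_mul, Complex.norm_real, Real.norm_of_nonneg (hr0 n).le]
    exact mul_lt_one_of_nonneg_of_lt_one_left (hr0 n).le (hr1 n) (mem_ball_zero_iff.mp z.2).le
  choose p hp using fun n : ℕ =>
    exists_polynomial_approx hF (hr0 n) (hr1 n) (Nat.one_div_pos_of_nat (α := ℝ) (n := n))
  refine ⟨p, fun n z => ?_, fun z => ?_⟩
  · have h1 := hp n z z.2
    have h2 : ‖extendZero f.1 (r n * z)‖ ≤ B := by
      rw [extendZero_of_mem _ (hscale n z)]; exact hB _
    have h3 : 1 / ((n : ℝ) + 1) ≤ 1 := by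
      rw [div_le_one (by positivity)]; linarith [n.cast_nonneg (α := ℝ)]
    have h4 := norm_le_norm_add_norm_sub' ((p n).eval (z : ℂ)) (extendZero f.1 (r n * z))
    linarith
  · have hcont : Tendsto (fun n => extendZero f.1 (r n * z)) atTop (𝓝 (f.1 z)) := by
      rw [← extendZero_apply f.1 z]
      refine ((hF.continuousOn.continuousAt (Metric.isOpen_ball.mem_nhds z.2)).tendsto).comp ?_
      have : Tendsto (fun n => ((r n : ℝ) : ℂ)) atTop (𝓝 ((1 : ℝ) : ℂ)) :=
        (Complex.continuous_ofReal.tendsto _).comp hrlim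
      simpa using this.mul_const (z : ℂ)
    have hdiff : Tendsto (fun n => (p n).eval (z : ℂ) - extendZero f.1 (r n * z)) atTop (𝓝 0) :=
      squeeze_zero_norm (fun n => (hp n z z.2).le) tendsto_one_div_add_atTop_nhds_zero_nat
    simpa using hdiff.add hcont

/-! ### Point evaluations on `H^2` -/

/-- Evaluation at `z ∈ 𝔻` as a bounded functional on `H^2`. -/
noncomputable def H2.evalCLM (z : Disc) : H2 →L[ℂ] ℂ :=
  LinearMap.mkContinuous
    { toFun := fun u => H2.eval u z
      map_add' := fun u v => by
        simp only [H2.eval]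
        rw [← (H2.summable_eval u z).tsum_add (H2.summable_eval v z)]
        exact tsum_congr fun n => add_mul _ _ _
      map_smul' := fun c u => by
        simp only [H2.eval, RingHom.id_apply, smul_eq_mul]
        rw [← tsum_mul_left]
        exact tsum_congr fun n => mul_assoc _ _ _ }
    (1 - ‖(z : ℂ)‖)⁻¹ fun u => by
      have hz : ‖(z : ℂ)‖ < 1 := mem_ball_zero_iff.mp z.2
      rw [mul_comm]
      refine tsum_of_norm_bounded ((hasSum_geometric_of_lt_one (norm_nonneg _) hz).mul_left ‖u‖)
        fun n => ?_
      rw [norm_mul, norm_pow]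
      exact mul_le_mul_of_nonneg_right (lp.norm_apply_le_norm (by simp) u n) (by positivity)

@[simp]
theorem H2.evalCLM_apply (z : Disc) (u : H2) : H2.evalCLM z u = H2.eval u z := rfl

theorem H2.eq_zero_of_eval_eq_zero {u : H2} (hu : ∀ z, H2.eval u z = 0) : u = 0 := by
  have hps : HasFPowerSeriesAt (0 : ℂ → ℂ) (FormalMultilinearSeries.ofScalars ℂ (u : ℕ → ℂ)) 0 := by
    rw [hasFPowerSeriesAt_iff]
    filter_upwards [Metric.ball_mem_nhds (0 : ℂ) one_pos] with z hz
    have := (H2.summable_eval u ⟨z, hz⟩).hasSum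
    rw [show ∑' n, u n * ((⟨z, hz⟩ : Disc) : ℂ) ^ n = 0 from hu ⟨z, hz⟩] at this
    simpa [mul_comm] using this
  ext n
  have := congrArg (fun q => q n (1 : Fin n → ℂ)) hps.eq_zero
  simpa using this

/-! ### Operators with a separating family of eigenfunctionals -/

section Calculus

variable {H : Type*} [NormedAddCommGroup H] [InnerProductSpace ℂ H]

theorem eval_eigenfunctional_aeval {T : H →L[ℂ] H} {E : Disc → H →L[ℂ] ℂ}
    (hET : ∀ z x, E z (T x) = z * E z x) (p : ℂ[X]) (z : Disc) (x : H) :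
    E z (aeval T p x) = p.eval (z : ℂ) * E z x := by
  induction p using Polynomial.induction_on' generalizing x with
  | add p q hp hq => simp [hp, hq, add_mul]
  | monomial n a =>
    have : ∀ n x, E z ((T ^ n) x) = (z : ℂ) ^ n * E z x := fun n => by
      induction n with
      | zero => simp
      | succ n ih => intro x; rw [pow_succ, mul_apply_eq_comp, ih, hET]; ring
    rw [aeval_monomial, mul_apply_eq_comp, Algebra.algebraMap_eq_smul_one, eval_monomial, mul_assoc,
      ← this, smul_apply, one_apply_eq_self, map_smul, smul_eq_mul]

theorem PolynomiallyBounded.exists_bound {T : H →L[ℂ] H} (hT : PolynomiallyBounded T) :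
    ∃ C : ℝ, 0 ≤ C ∧ ∀ (p : ℂ[X]) (B : ℝ), (∀ z : Disc, ‖p.eval (z : ℂ)‖ ≤ B) →
      ‖aeval T p‖ ≤ C * B := by
  obtain ⟨C, hC⟩ := hT
  have : Nonempty Disc := ⟨⟨0, by simp⟩⟩
  refine ⟨max C 0, le_max_right _ _, fun p B hB => (hC p).trans ?_⟩
  exact mul_le_mul (le_max_left _ _) (ciSup_le hB) (Real.iSup_nonneg fun _ => norm_nonneg _)
    (le_max_right _ _)

variable [CompleteSpace H]

/-- The Riesz vectors of a separating family have dense span, and for a bounded sequence weak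
convergence need only be tested on a dense set. -/
theorem tendsto_inner_of_separating {ι : Type*} {E : ι → H →L[ℂ] ℂ}
    (hE : ∀ x, (∀ i, E i x = 0) → x = 0) {v : ℕ → H} {w : H} {B : ℝ} (hv : ∀ n, ‖v n‖ ≤ B)
    (hlim : ∀ i, Tendsto (fun n => E i (v n)) atTop (𝓝 (E i w))) (y : H) :
    Tendsto (fun n => inner ℂ y (v n)) atTop (𝓝 (inner ℂ y w)) := by
  set k : ι → H := fun i => (InnerProductSpace.toDual ℂ H).symm (E i) with hk
  have hkE : ∀ i x, inner ℂ (k i) x = E i x := fun i x => by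
    rw [hk, InnerProductSpace.toDual_symm_apply]
  have hdense : Dense (Submodule.span ℂ (Set.range k) : Set H) := by
    rw [Submodule.dense_iff_topologicalClosure_eq_top,
      Submodule.topologicalClosure_eq_top_iff, Submodule.eq_bot_iff]
    intro x hx
    refine hE x fun i => ?_
    rw [← hkE]
    exact (Submodule.mem_orthogonal _ _).mp hx _ (Submodule.subset_span ⟨i, rfl⟩)
  have hspan : ∀ y ∈ Submodule.span ℂ (Set.range k),
      Tendsto (fun n => inner ℂ y (v n)) atTop (𝓝 (inner ℂ y w)) := by
    intro y hy
    induction hy using Submodule.span_induction with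
    | mem y hy =>
      obtain ⟨i, rfl⟩ := hy
      simpa only [hkE] using hlim i
    | zero => simp
    | add a b _ _ ha hb => simpa only [inner_add_left] using ha.add hb
    | smul c a _ ha => simpa only [inner_smul_left] using ha.const_mul _
  rw [Metric.tendsto_atTop]
  intro ε hε
  have hB : 0 ≤ B := (norm_nonneg _).trans (hv 0)
  have hD : 0 < B + ‖w‖ + 1 := by positivity
  obtain ⟨y', hy', hyy'⟩ := hdense.exists_dist_lt y (div_pos (half_pos hε) hD)
  obtain ⟨N, hN⟩ := Metric.tendsto_atTop.mp (hspan y' hy') (ε / 2) (half_pos hε)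
  refine ⟨N, fun n hn => ?_⟩
  have h1 := hN n hn
  rw [dist_eq_norm, ← inner_sub_right] at h1 ⊢
  have h2 : ‖inner ℂ (y - y') (v n - w)‖ ≤ ε / 2 := by
    refine (norm_inner_le_norm _ _).trans ?_
    rw [dist_eq_norm] at hyy'
    have h3 : ‖v n - w‖ ≤ B + ‖w‖ + 1 := by
      linarith [norm_sub_le (v n) w, hv n]
    calc ‖y - y'‖ * ‖v n - w‖ ≤ ε / 2 / (B + ‖w‖ + 1) * (B + ‖w‖ + 1) :=
          mul_le_mul hyy'.le h3 (norm_nonneg _) (by positivity)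
      _ = ε / 2 := div_mul_cancel₀ _ hD.ne'
  have h4 : inner ℂ y (v n - w) = inner ℂ (y - y') (v n - w) + inner ℂ y' (v n - w) := by
    rw [← inner_add_left, sub_add_cancel]
  rw [h4]
  linarith [norm_add_le (inner ℂ (y - y') (v n - w)) (inner ℂ y' (v n - w))]

/-- Banach–Alaoglu, with the limit taken along a free ultrafilter on `ℕ`. -/
theorem exists_weak_limit {ι : Type*} {E : ι → H →L[ℂ] ℂ} {v : ℕ → H} {B : ℝ}
    (hv : ∀ n, ‖v n‖ ≤ B) {c : ι → ℂ}
    (hlim : ∀ i, Tendsto (fun n => E i (v n)) atTop (𝓝 (c i))) :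
    ∃ w, ‖w‖ ≤ B ∧ ∀ i, E i w = c i := by
  have hcpt := WeakDual.isCompact_closedBall (𝕜 := ℂ) (E := H) 0 B
  set φ : ℕ → WeakDual ℂ H := fun n =>
    StrongDual.toWeakDual (InnerProductSpace.toDual ℂ H (v n)) with hφ
  obtain ⟨ψ, hψ, hle⟩ := hcpt.ultrafilter_le_nhds ((hyperfilter ℕ).map φ) (by
    rw [Filter.le_principal_iff]
    refine Filter.mem_map.mpr (Filter.univ_mem' fun n => ?_)
    simpa [hφ] using hv n)
  set w := (InnerProductSpace.toDual ℂ H).symm (WeakDual.toStrongDual ψ) with hw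
  refine ⟨w, by simpa [hw] using hψ, fun i => ?_⟩
  set k := (InnerProductSpace.toDual ℂ H).symm (E i)
  have hkE : ∀ x, inner ℂ k x = E i x := fun x => InnerProductSpace.toDual_symm_apply
  have h1 : Tendsto (fun n => φ n k) (hyperfilter ℕ) (𝓝 (ψ k)) :=
    ((WeakDual.eval_continuous k).tendsto ψ).comp hle
  have h2 : Tendsto (fun n => E i (v n)) (hyperfilter ℕ) (𝓝 (E i w)) := by
    -- `φ n k` is the inner product of `v n` with `k`, the conjugate of `E i (v n)`.
    have h3 := (Complex.continuous_conj.tendsto _).comp h1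
    have h4 : ψ k = inner ℂ w k := InnerProductSpace.toDual_symm_apply.symm
    rw [h4, inner_conj_symm, hkE] at h3
    refine h3.congr fun n => ?_
    rw [← hkE]
    exact inner_conj_symm _ _
  exact tendsto_nhds_unique h2 ((hlim i).mono_left Nat.hyperfilter_le_atTop)

/-- `C` is independent of `f` and `B`; weak-* continuity of the calculus rests on this uniformity.
-/
theorem exists_mul_bounded {T : H →L[ℂ] H} (hT : PolynomiallyBounded T) {E : Disc → H →L[ℂ] ℂ}
    (hET : ∀ z x, E z (T x) = z * E z x) :
    ∃ C : ℝ, 0 ≤ C ∧ ∀ (f : HInfty) (B : ℝ), (∀ z, ‖f.1 z‖ ≤ B) →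
      ∀ x, ∃ w, ‖w‖ ≤ C * (B + 1) * ‖x‖ ∧ ∀ z, E z w = f.1 z * E z x := by
  obtain ⟨C, hC0, hC⟩ := hT.exists_bound
  refine ⟨C, hC0, fun f B hB x => ?_⟩
  obtain ⟨p, hpB, hp⟩ := exists_polynomial_tendsto f hB
  refine exists_weak_limit (v := fun n => aeval T (p n) x)
    (fun n => ContinuousLinearMap.le_of_opNorm_le _ (hC _ _ (hpB n)) x) fun z => ?_
  simpa only [eval_eigenfunctional_aeval hET] using (hp z).mul_const _

theorem exists_calculus {T : H →L[ℂ] H} (hT : PolynomiallyBounded T) {E : Disc → H →L[ℂ] ℂ}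
    (hE : ∀ x, (∀ z, E z x = 0) → x = 0) (hET : ∀ z x, E z (T x) = z * E z x) :
    ∃ Φ : HInfty →ₐ[ℂ] (H →L[ℂ] H), IsHInftyCalculus T Φ ∧
      ∀ f x z, E z (Φ f x) = f.1 z * E z x := by
  obtain ⟨C, hC0, hC⟩ := exists_mul_bounded hT hET
  have hext : ∀ {x y : H}, (∀ z, E z x = E z y) → x = y := fun {x y} h =>
    sub_eq_zero.mp (hE _ fun z => by rw [map_sub, h, sub_self])
  choose m hmB hm using fun f : HInfty => hC f f.2.2.choose f.2.2.choose_spec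
  let M : HInfty → H →L[ℂ] H := fun f => LinearMap.mkContinuous
    { toFun := m f
      map_add' := fun x y => hext fun z => by simp only [hm, map_add, mul_add]
      map_smul' := fun c x => hext fun z => by
        simp only [hm, map_smul, RingHom.id_apply, smul_eq_mul]; ring } _ (hmB f)
  have hM : ∀ f x z, E z (M f x) = f.1 z * E z x := fun f x z => hm f x z
  let Φ : HInfty →ₐ[ℂ] (H →L[ℂ] H) :=
    { toFun := M
      map_one' := by ext x; exact hext fun z => by simp [hM]
      map_mul' := fun f g => by ext x; exact hext fun z => by simp [hM, mul_assoc]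
      map_zero' := by ext x; exact hext fun z => by simp [hM]
      map_add' := fun f g => by ext x; exact hext fun z => by simp [hM, add_mul]
      commutes' := fun c => by
        ext x; exact hext fun z => by simp [hM, Algebra.algebraMap_eq_smul_one] }
  have hΦ : ∀ f x z, E z (Φ f x) = f.1 z * E z x := hM
  refine ⟨Φ, ⟨?_, fun f f₀ hbdd hlim x y => ?_⟩, hΦ⟩
  · ext x
    exact hext fun z => by rw [hΦ, hET]; rfl
  · obtain ⟨B, hB⟩ := hbdd
    refine tendsto_inner_of_separating hE (B := C * (B + 1) * ‖x‖) (fun n => ?_) (fun z => ?_) y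
    -- Each `Φ (f n)` was built from its own bound for `f n`; rebuilding its value at `x` from the
    -- common bound `B` gives the same vector, as `E` separates points.
    · obtain ⟨w, hw, hwE⟩ := hC (f n) B (hB n) x
      rwa [hext (x := Φ (f n) x) (y := w) fun z => by rw [hΦ, hwE]]
    · simpa only [hΦ] using (hlim z).mul_const _

end Calculus

/-! ### Uniqueness of the calculus, and norm estimates for isometric asymptotes -/

section Asymptote

variable {H : Type*} [NormedAddCommGroup H] [InnerProductSpace ℂ H]
variable {K : Type*} [NormedAddCommGroup K] [InnerProductSpace ℂ K]

/-- A calculus is forced on polynomials, and these are boundedly pointwise sequentially dense. -/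
theorem IsHInftyCalculus.unique {T : H →L[ℂ] H} {Φ Ψ : HInfty →ₐ[ℂ] (H →L[ℂ] H)}
    (hΦ : IsHInftyCalculus T Φ) (hΨ : IsHInftyCalculus T Ψ) : Φ = Ψ := by
  ext f x
  obtain ⟨B, hB⟩ := f.2.2
  obtain ⟨p, hpB, hp⟩ := exists_polynomial_tendsto f hB
  have heval : ∀ (q : ℂ[X]) (z : Disc), (aeval coordFun q : HInfty).1 z = q.eval (z : ℂ) := by
    intro q z
    have h1 : (aeval coordFun q : HInfty).1 = aeval coordFun.1 q :=
      (aeval_algHom_apply HInfty.val coordFun q).symm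
    have h2 : (aeval coordFun.1 q : Disc → ℂ) z = aeval (coordFun.1 z) q :=
      (aeval_algHom_apply (Pi.evalAlgHom ℂ (fun _ : Disc => ℂ) z) coordFun.1 q).symm
    rw [h1, h2, coe_aeval_eq_eval]
    rfl
  have key : ∀ {Θ : HInfty →ₐ[ℂ] (H →L[ℂ] H)}, IsHInftyCalculus T Θ → ∀ y,
      Tendsto (fun n => inner ℂ y (aeval T (p n) x)) atTop (𝓝 (inner ℂ y (Θ f x))) := by
    intro Θ hΘ y
    refine (hΘ.weakStar (fun n => aeval coordFun (p n)) f ⟨B + 1, fun n z => ?_⟩ (fun z => ?_)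
      x y).congr fun n => ?_
    · rw [heval]; exact hpB n z
    · simpa only [heval] using hp z
    · rw [← aeval_algHom_apply, hΘ.map_coord]
  exact ext_inner_left ℂ fun y => tendsto_nhds_unique (key hΦ y) (key hΨ y)

theorem IsBanachLimit.mono {L : (ℕ →ᵇ ℝ) →ₗ[ℝ] ℝ} (hL : IsBanachLimit L) {s t : ℕ →ᵇ ℝ}
    (h : ∀ n, s n ≤ t n) : L s ≤ L t := by
  have := hL.nonneg (t - s) fun n => by simpa using h n
  rw [map_sub] at this
  linarith

theorem IsCanonicalAsymptote.le_norm_of_forall_le {T : H →L[ℂ] H} {Y : H →L[ℂ] K} {V : K →L[ℂ] K}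
    (hY : IsCanonicalAsymptote T Y V) {a : ℝ} (ha : 0 ≤ a) {x : H}
    (h : ∀ n, a ≤ ‖(T ^ n) x‖) : a ≤ ‖Y x‖ := by
  obtain ⟨L, hL, hs⟩ := hY.norm_eq
  obtain ⟨s, hsn, hsY⟩ := hs x
  have h1 : L (a ^ 2 • (1 : ℕ →ᵇ ℝ)) ≤ L s := hL.mono fun n => by
    simpa [hsn] using pow_le_pow_left₀ ha (h n) 2
  rw [map_smul, hL.one, smul_eq_mul, mul_one, ← hsY] at h1
  exact le_of_sq_le_sq h1 (norm_nonneg _)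

/-- Commutation lets `A` be pulled out of every term of the orbit before the Banach limit is taken.
-/
theorem IsCanonicalAsymptote.norm_apply_le_of_commute {T : H →L[ℂ] H} {Y : H →L[ℂ] K}
    {V : K →L[ℂ] K} (hY : IsCanonicalAsymptote T Y V) {A : H →L[ℂ] H} (hA : Commute A T) (x : H) :
    ‖Y (A x)‖ ≤ ‖A‖ * ‖Y x‖ := by
  obtain ⟨L, hL, hs⟩ := hY.norm_eq
  obtain ⟨s, hsn, hsY⟩ := hs x
  obtain ⟨t, htn, htY⟩ := hs (A x)
  have h1 : L t ≤ L (‖A‖ ^ 2 • s) := hL.mono fun n => by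
    have h2 : (T ^ n) (A x) = A ((T ^ n) x) :=
      (DFunLike.congr_fun (hA.pow_right n).eq x).symm
    have h3 := pow_le_pow_left₀ (norm_nonneg _) (A.le_opNorm ((T ^ n) x)) 2
    rw [mul_pow] at h3
    simpa [hsn, htn, h2] using h3
  rw [map_smul, smul_eq_mul, ← hsY, ← htY, ← mul_pow] at h1
  exact le_of_sq_le_sq h1 (by positivity)

theorem IsIsometricAsymptote.intertwine {T : H →L[ℂ] H} {Y : H →L[ℂ] K} {V : K →L[ℂ] K}
    (hY : IsIsometricAsymptote T Y V) (x : H) : Y (T x) = V (Y x) := by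
  obtain ⟨-, Y₀, V₀, Z, h₀, hYZ, hZ⟩ := hY
  rw [hYZ, hYZ, h₀.intertwine, hZ]

/-- The powers of an operator similar to an isometry are uniformly bounded below. -/
theorem AreSimilar.exists_le_norm_pow {T : H →L[ℂ] H} {V : K →L[ℂ] K} (hT : AreSimilar T V)
    (hV : Isometry V) : ∃ C : ℝ, 0 ≤ C ∧ ∀ n x, ‖x‖ ≤ C * ‖(T ^ n) x‖ := by
  obtain ⟨Z, hZ⟩ := hT
  have hpow : ∀ n x, ‖Z ((T ^ n) x)‖ = ‖Z x‖ := fun n => by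
    induction n with
    | zero => simp
    | succ n ih =>
      intro x
      rw [pow_succ, mul_apply_eq_comp, ih, hZ]
      exact hV.norm_map_of_map_zero (map_zero V) _
  refine ⟨‖(Z.symm : K →L[ℂ] H)‖ * ‖(Z : H →L[ℂ] K)‖, by positivity, fun n x => ?_⟩
  calc ‖x‖ = ‖(Z.symm : K →L[ℂ] H) (Z x)‖ := by simp
    _ ≤ ‖(Z.symm : K →L[ℂ] H)‖ * ‖Z x‖ := ContinuousLinearMap.le_opNorm _ _
    _ = ‖(Z.symm : K →L[ℂ] H)‖ * ‖(Z : H →L[ℂ] K) ((T ^ n) x)‖ := by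
      rw [ContinuousLinearEquiv.coe_coe, hpow]
    _ ≤ _ := by
      rw [mul_assoc]
      gcongr
      exact ContinuousLinearMap.le_opNorm _ _

theorem areSimilar_of_norm_le [CompleteSpace H] [CompleteSpace K] {T : H →L[ℂ] H} {Y : H →L[ℂ] K}
    {V : K →L[ℂ] K} (hYT : ∀ x, Y (T x) = V (Y x)) (hdense : DenseRange Y) {C : ℝ} (hC : 0 ≤ C)
    (h : ∀ x, ‖x‖ ≤ C * ‖Y x‖) : AreSimilar T V := by
  have hanti : AntilipschitzWith C.toNNReal Y :=
    Y.antilipschitz_of_bound fun x => by simpa [Real.coe_toNNReal _ hC] using h x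
  have hsurj : Function.Surjective Y := by
    rw [← Set.range_eq_univ, ← (hanti.isClosed_range Y.uniformContinuous).closure_eq,
      hdense.closure_range]
  exact ⟨ContinuousLinearEquiv.ofBijective Y (LinearMap.ker_eq_bot.mpr hanti.injective)
    (LinearMap.range_eq_top.mpr hsurj), hYT⟩

theorem IsIsometricAsymptote.areSimilar_of_decomposition [CompleteSpace H] [CompleteSpace K]
    {T : H →L[ℂ] H} {Y : H →L[ℂ] K} {V : K →L[ℂ] K} (hY : IsIsometricAsymptote T Y V)
    (hdense : DenseRange Y) {X : K →L[ℂ] H} {A B : H →L[ℂ] H} (hA : Commute A T) (hB : Commute B T)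
    (hsum : ∀ x, x = X (Y (A x)) + B x) {C : ℝ} (hC : 0 ≤ C)
    (hBT : ∀ n x, ‖B x‖ ≤ C * ‖(T ^ n) (B x)‖) : AreSimilar T V := by
  have hYT := hY.intertwine
  obtain ⟨-, Y₀, V₀, Z, h₀, hYZ, -⟩ := hY
  have hY₀ : ∀ x, ‖Y₀ x‖ ≤ ‖(Z.symm : K →L[ℂ] K)‖ * ‖Y x‖ := fun x => by
    have := (Z.symm : K →L[ℂ] K).le_opNorm (Y x)
    simpa [hYZ] using this
  have h1 : ∀ x, ‖B x‖ ≤ C * ‖B‖ * ‖Y₀ x‖ := fun x => by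
    -- Scaling the vector by `C` avoids dividing by a possibly zero `C`.
    have h2 : ‖B x‖ ≤ ‖Y₀ (C • B x)‖ := h₀.le_norm_of_forall_le (norm_nonneg _) fun n => by
      rw [ContinuousLinearMap.map_smul_of_tower, norm_smul, Real.norm_of_nonneg hC]
      exact hBT n x
    rw [ContinuousLinearMap.map_smul_of_tower, norm_smul, Real.norm_of_nonneg hC] at h2
    rw [mul_assoc]
    exact h2.trans (mul_le_mul_of_nonneg_left (h₀.norm_apply_le_of_commute hB x) hC)
  have h3 : ∀ x, ‖X (Y (A x))‖ ≤ ‖X‖ * ‖(Z : K →L[ℂ] K)‖ * ‖A‖ * ‖Y₀ x‖ := fun x => by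
    have h4 : ‖Y (A x)‖ ≤ ‖(Z : K →L[ℂ] K)‖ * ‖Y₀ (A x)‖ := by
      rw [hYZ]; exact (Z : K →L[ℂ] K).le_opNorm _
    calc ‖X (Y (A x))‖ ≤ ‖X‖ * (‖(Z : K →L[ℂ] K)‖ * (‖A‖ * ‖Y₀ x‖)) :=
          (X.le_opNorm _).trans (by
            gcongr
            exact h4.trans (by gcongr; exact h₀.norm_apply_le_of_commute hA x))
      _ = _ := by ring
  refine areSimilar_of_norm_le hYT hdense
    (C := (‖X‖ * ‖(Z : K →L[ℂ] K)‖ * ‖A‖ + C * ‖B‖) * ‖(Z.symm : K →L[ℂ] K)‖) (by positivity)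
    fun x => ?_
  calc ‖x‖ ≤ ‖X (Y (A x))‖ + ‖B x‖ := by
        conv_lhs => rw [hsum x]
        exact norm_add_le _ _
    _ ≤ (‖X‖ * ‖(Z : K →L[ℂ] K)‖ * ‖A‖ + C * ‖B‖) * ‖Y₀ x‖ := by
        rw [add_mul]; exact add_le_add (h3 x) (h1 x)
    _ ≤ _ := by
        rw [mul_assoc _ _ ‖Y x‖]
        gcongr
        exact hY₀ x

end Asymptote

end HardyOp

open HardyOp
theorem lemma2p5 {H : Type*} [NormedAddCommGroup H] [InnerProductSpace ℂ H] [CompleteSpace H]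
    (g η h ω : HInfty) (hω : IsInnerFun ω) (hone : 1 = g * η + ω * h)
    (T : H →L[ℂ] H) (hT : PolynomiallyBounded T)
    (Y : H →L[ℂ] H2) (hY : Quasiaffinity Y) (hYS : IsIsometricAsymptote T Y shift)
    (X : H2 →L[ℂ] H) (hYX : IsMulBy g (Y ∘L X)) :
    (∃! Φ : HInfty →ₐ[ℂ] (H →L[ℂ] H), IsHInftyCalculus T Φ) ∧
    ∀ (Φ : HInfty →ₐ[ℂ] (H →L[ℂ] H)) (hΦ : IsHInftyCalculus T Φ),
      AreSimilar (T.restrict (hΦ.invariant ω)) shift → AreSimilar T shift := by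
  set E : Disc → H →L[ℂ] ℂ := fun z => H2.evalCLM z ∘L Y with hEdef
  have hE : ∀ x, (∀ z, E z x = 0) → x = 0 := fun x hx =>
    hY.1 ((H2.eq_zero_of_eval_eq_zero hx).trans (map_zero Y).symm)
  have hET : ∀ z x, E z (T x) = z * E z x := fun z x => by
    simp [hEdef, hYS.intertwine, H2.eval_shift]
  obtain ⟨Ψ, hΨ, hΨE⟩ := exists_calculus hT hE hET
  refine ⟨⟨Ψ, hΨ, fun Φ hΦ => hΦ.unique hΨ⟩, fun Φ hΦ hsim => ?_⟩
  obtain rfl := hΦ.unique hΨ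
  -- Both sides have image `g · Yx` under `Y`.
  have hXY : ∀ x, X (Y x) = Φ g x := fun x => sub_eq_zero.mp <| hE _ fun z => by
    rw [map_sub, hΨE, sub_eq_zero]
    exact hYX (Y x) z
  have hcomm : ∀ f, Commute (Φ f) T := fun f => by
    rw [← hΦ.map_coord]
    exact (Commute.all f coordFun).map Φ
  obtain ⟨C, hC, hCT⟩ := hsim.exists_le_norm_pow hYS.1
  refine hYS.areSimilar_of_decomposition hY.2 (X := X) (hcomm η) (hcomm (ω * h)) (fun x => ?_) hC
    fun n x => ?_
  · rw [hXY, ← mul_apply_eq_comp, ← map_mul, ← add_apply,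
      ← map_add, ← hone, map_one, one_apply_eq_self]
  · have hmem : Φ (ω * h) x ∈ closRange (Φ ω) := by
      rw [map_mul]
      exact Submodule.le_topologicalClosure _ ⟨Φ h x, rfl⟩
    have hpow : ∀ (n : ℕ) (y : closRange (Φ ω)),
        (((T.restrict (hΦ.invariant ω)) ^ n) y : H) = (T ^ n) y := fun n => by
      induction n with
      | zero => simp
      | succ n ih => intro y; rw [pow_succ, mul_apply_eq_comp, ih]; rfl
    have := hCT n ⟨_, hmem⟩
    rwa [← Submodule.norm_coe, ← Submodule.norm_coe, hpow] at this
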